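/- For $n\ge 1$, $\beta>0$ and $K\in\mathbb{R}$, the mean-field Blume--Capel model on $n$ vertices is the probability measure $P_{n,\beta,K}(\omega)=Z_n(\beta,K)^{-1}\exp[-\beta H_{n,K}(\omega)]$ on $\{-1,0,1\}^n$, where $H_{n,K}(\omega)=\sum_{j=1}^n\omega_j^2-\frac{K}{n}\bigl(\sum_{j=1}^n\omega_j\bigr)^2$ and $Z_n(\beta,K)$ is the normalizing constant. Its Glauber dynamics is the Markov chain on $\{-1,0,1\}^n$ that at each step selects a vertex $i$ uniformly at random and resamples the spin at $i$ from $P_{n,\beta,K}$ conditioned to agree with the current spins at all other vertices. Let $P^t(\omega,\cdot)$ denote its $t$-step transition probabilities and let $t_{mix}(\varepsilon)=\min\{t\ge 0:\max_{\omega}\|P^t(\omega,\cdot)-P_{n,\beta,K}\|_{TV}\le\varepsilon\}$ be its mixing time, where $\|\mu-\nu\|_{TV}=\sup_A|\mu(A)-\nu(A)|$. Let $c_\beta(t)=\log\frac{1+e^{-\beta}(e^t+e^{-t})}{1+2e^{-\beta}}$, $G_{\beta,K}(z)=\beta Kz^2-c_\beta(2\beta Kz)$, $\beta_c=\log 4$,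 and, for $0<\beta\le\beta_c$, $K_c^{(2)}(\beta)=\frac{1}{2\beta c_\beta''(0)}=\frac{e^\beta+2}{4\beta}$. For $\beta>\beta_c$ there is a unique value $K_1(\beta)>0$ of $K$ for which there exists a unique $z>0$ with $G_{\beta,K}'(z)=0$ and $G_{\beta,K}''(z)=0$. Then there exist a constant $b>0$ and a strictly positive function $r(\beta,K)$ such that, whenever (a) $0<\beta\le\beta_c$ and $K>K_c^{(2)}(\beta)$, or (b) $\beta>\beta_c$ and $K>K_1(\beta)$, one has for every $n\ge 1$ $$t_{mix}(1/4)\ \ge\ b\,e^{r(\beta,K)\,n}.$$ -/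

import Mathlib

namespace BlumeCapel

noncomputable section

/-- Configurations on `n` vertices, i.e. `{-1, 0, 1}^n`. -/
abbrev Config (n : ℕ) : Type := Fin n → SignType

/-- The total spin `S_n(ω) = ∑ⱼ ωⱼ`. -/
def totalSpin {n : ℕ} (ω : Config n) : ℝ := ∑ j, (ω j : ℝ)

/-- The Hamiltonian `H_{n,K}(ω) = ∑ⱼ ωⱼ² - (K/n) (∑ⱼ ωⱼ)²`. -/
def hamiltonian (n : ℕ) (K : ℝ) (ω : Config n) : ℝ :=
  ∑ j, (ω j : ℝ) ^ 2 - K / n * totalSpin ω ^ 2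

/-- The partition function `Z_n(β, K)`. -/
def partitionFunction (n : ℕ) (β K : ℝ) : ℝ :=
  ∑ ω : Config n, Real.exp (-β * hamiltonian n K ω)

/-- The Gibbs measure `P_{n,β,K}`, given by its point masses. -/
def gibbs (n : ℕ) (β K : ℝ) (ω : Config n) : ℝ :=
  Real.exp (-β * hamiltonian n K ω) / partitionFunction n β K

/-- The probability that the spin at `i` is `s` under the Gibbs measure, conditioned to agree with
`ω` at all vertices other than `i`. -/
def updateProb (n : ℕ) (β K : ℝ) (ω : Config n) (i : Fin n) (s : SignType) : ℝ :=
  gibbs n β K (Function.update ω i s) /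
    ∑ s' : SignType, gibbs n β K (Function.update ω i s')

/-- Transition matrix of the Glauber dynamics: choose a vertex uniformly at random and resample its
spin from the conditional Gibbs measure. -/
def glauber (n : ℕ) (β K : ℝ) : Matrix (Config n) (Config n) ℝ :=
  fun ω τ => (1 / (n : ℝ)) * ∑ i : Fin n, ∑ s : SignType,
    if Function.update ω i s = τ then updateProb n β K ω i s else 0

/-- Total variation distance of two distributions on a finite set, `sup_A |μ(A) - ν(A)|`. -/
def tvDist {Ω : Type*} [Fintype Ω] (μ ν : Ω → ℝ) : ℝ :=
  ⨆ A : Finset Ω, |∑ x ∈ A, μ x - ∑ x ∈ A, ν x|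

/-- `d(t)`: the maximal total variation distance to the stationary (Gibbs) measure after `t` steps
of the Glauber dynamics. -/
def maxDist (n : ℕ) (β K : ℝ) (t : ℕ) : ℝ :=
  ⨆ ω : Config n, tvDist ((glauber n β K ^ t) ω) (gibbs n β K)

/-- The mixing time `min {t : d(t) ≤ ε}` of the Glauber dynamics. (If the set were empty, this
would be `0`, so that a positive lower bound on it includes that the minimum exists.) -/
def mixingTime (n : ℕ) (β K ε : ℝ) : ℕ := sInf {t : ℕ | maxDist n β K t ≤ ε}

/-- The cumulant generating function `c_β` of the single-spin measure. -/
def cumulant (β t : ℝ) : ℝ :=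
  Real.log ((1 + Real.exp (-β) * (Real.exp t + Real.exp (-t))) / (1 + 2 * Real.exp (-β)))

/-- The free energy functional `G_{β,K}(z) = β K z² - c_β(2 β K z)`. -/
def freeEnergy (β K z : ℝ) : ℝ := β * K * z ^ 2 - cumulant β (2 * β * K * z)

/-- `β_c = log 4`. -/
def betaC : ℝ := Real.log 4

/-- The second-order critical value `K_c^{(2)}(β) = 1 / (2 β c_β''(0))`. -/
def KcTwo (β : ℝ) : ℝ := 1 / (2 * β * deriv (deriv (cumulant β)) 0)

/-- `K` is a positive value for which there is a unique `z > 0` with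
`G_{β,K}'(z) = 0` and `G_{β,K}''(z) = 0`. -/
def IsMetastableCriticalValue (β K : ℝ) : Prop :=
  0 < K ∧ ∃! z : ℝ, 0 < z ∧ deriv (freeEnergy β K) z = 0 ∧ deriv (deriv (freeEnergy β K)) z = 0

end

end BlumeCapel

namespace BlumeCapel

open Finset

section FiniteMarkovChain

variable {Ω : Type*} [Fintype Ω]

theorem abs_sum_sub_sum_le_tvDist (μ ν : Ω → ℝ) (A : Finset Ω) :
    |∑ x ∈ A, μ x - ∑ x ∈ A, ν x| ≤ tvDist μ ν :=
  le_ciSup (f := fun A : Finset Ω => |∑ x ∈ A, μ x - ∑ x ∈ A, ν x|)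
    (Set.finite_range _).bddAbove A

variable [DecidableEq Ω] {P : Matrix Ω Ω ℝ} {π : Ω → ℝ}

theorem pow_apply_nonneg (hP : ∀ x y, 0 ≤ P x y) (t : ℕ) (x y : Ω) : 0 ≤ (P ^ t) x y := by
  induction t generalizing x y with
  | zero => simp only [pow_zero, Matrix.one_apply]; split_ifs <;> norm_num
  | succ t ih =>
    rw [pow_succ, Matrix.mul_apply]
    exact sum_nonneg fun z _ => mul_nonneg (ih x z) (hP z y)

theorem sum_pow_apply (hP1 : ∀ x, ∑ y, P x y = 1) (t : ℕ) (x : Ω) : ∑ y, (P ^ t) x y = 1 := by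
  induction t generalizing x with
  | zero => simp [Matrix.one_apply]
  | succ t ih =>
    simp only [pow_succ, Matrix.mul_apply]
    rw [sum_comm]
    simp only [← mul_sum, hP1, mul_one, ih]

theorem stationary_pow (hπ : ∀ y, ∑ x, π x * P x y = π y) (t : ℕ) (y : Ω) :
    ∑ x, π x * (P ^ t) x y = π y := by
  induction t generalizing y with
  | zero => simp [Matrix.one_apply]
  | succ t ih =>
    simp only [pow_succ, Matrix.mul_apply, mul_sum]
    rw [sum_comm]
    simp only [← mul_assoc, ← sum_mul, ih, hπ]

/-- Mass that has left `A` after `t` steps of a stationary chain started in `A`. -/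
theorem escape_mass_le (hP : ∀ x y, 0 ≤ P x y) (hP1 : ∀ x, ∑ y, P x y = 1)
    (hπ0 : ∀ x, 0 ≤ π x) (hπ : ∀ y, ∑ x, π x * P x y = π y) (A : Finset Ω) (t : ℕ) :
    ∑ x ∈ A, π x * ∑ y ∈ Aᶜ, (P ^ t) x y ≤ t * ∑ x ∈ A, π x * ∑ y ∈ Aᶜ, P x y := by
  induction t with
  | zero =>
    simp only [pow_zero, CharP.cast_eq_zero, zero_mul]
    refine (sum_eq_zero fun x hx => ?_).le
    rw [sum_eq_zero, mul_zero]
    intro y hy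
    rw [Matrix.one_apply_ne]
    rintro rfl
    exact (mem_compl.1 hy) hx
  | succ t ih =>
    have hsplit : ∑ x ∈ A, π x * ∑ y ∈ Aᶜ, (P ^ (t + 1)) x y
        = ∑ z, (∑ x ∈ A, π x * (P ^ t) x z) * ∑ y ∈ Aᶜ, P z y := by
      simp only [pow_succ, Matrix.mul_apply, mul_sum, sum_mul]
      rw [sum_comm]
      conv_rhs => rw [sum_comm]
      refine sum_congr rfl fun y _ => ?_
      rw [sum_comm]
      simp only [mul_assoc]
    have hin : ∑ z ∈ A, (∑ x ∈ A, π x * (P ^ t) x z) * ∑ y ∈ Aᶜ, P z y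
        ≤ ∑ z ∈ A, π z * ∑ y ∈ Aᶜ, P z y := by
      refine sum_le_sum fun z _ => mul_le_mul_of_nonneg_right ?_ (sum_nonneg fun y _ => hP z y)
      rw [← stationary_pow hπ t z]
      exact sum_le_sum_of_subset_of_nonneg (subset_univ A)
        fun x _ _ => mul_nonneg (hπ0 x) (pow_apply_nonneg hP t x z)
    have hout : ∑ z ∈ Aᶜ, (∑ x ∈ A, π x * (P ^ t) x z) * ∑ y ∈ Aᶜ, P z y
        ≤ ∑ x ∈ A, π x * ∑ y ∈ Aᶜ, (P ^ t) x y := by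
      have hcomm : ∑ x ∈ A, π x * ∑ y ∈ Aᶜ, (P ^ t) x y
          = ∑ y ∈ Aᶜ, ∑ x ∈ A, π x * (P ^ t) x y := by
        simp only [mul_sum]
        exact sum_comm
      rw [hcomm]
      refine sum_le_sum fun z _ => ?_
      refine mul_le_of_le_one_right
        (sum_nonneg fun x _ => mul_nonneg (hπ0 x) (pow_apply_nonneg hP t x z)) ?_
      rw [← hP1 z]
      exact sum_le_sum_of_subset_of_nonneg (subset_univ _) fun y _ _ => hP z y
    rw [hsplit, ← sum_add_sum_compl A]
    push_cast
    linarith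

/-- The bottleneck bound: a chain that has mixed to within `1/4` has had time to leave `A`. -/
theorem mass_le_of_tvDist_le (hP : ∀ x y, 0 ≤ P x y) (hP1 : ∀ x, ∑ y, P x y = 1)
    (hπ0 : ∀ x, 0 ≤ π x) (hπ1 : ∑ x, π x = 1) (hπ : ∀ y, ∑ x, π x * P x y = π y)
    (A : Finset Ω) (hA : ∑ x ∈ A, π x ≤ 1 / 2) (t : ℕ)
    (ht : ∀ x, tvDist ((P ^ t) x) π ≤ 1 / 4) :
    ∑ x ∈ A, π x ≤ 4 * (t * ∑ x ∈ A, π x * ∑ y ∈ Aᶜ, P x y) := by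
  have hAc : (1 : ℝ) / 2 ≤ ∑ x ∈ Aᶜ, π x := by
    have := sum_add_sum_compl A π
    linarith
  have hge : ∑ x ∈ A, π x * (1 / 4) ≤ ∑ x ∈ A, π x * ∑ y ∈ Aᶜ, (P ^ t) x y := by
    refine sum_le_sum fun x _ => mul_le_mul_of_nonneg_left ?_ (hπ0 x)
    have := (abs_le.1 ((abs_sum_sub_sum_le_tvDist ((P ^ t) x) π Aᶜ).trans (ht x))).1
    linarith
  have := escape_mass_le hP hP1 hπ0 hπ A t
  rw [← sum_mul] at hge
  linarith

/-- Contraction of mean-zero functions under a chain whose transition probabilities dominate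
`δ π`. -/
theorem abs_sum_pow_mul_le (hP1 : ∀ x, ∑ y, P x y = 1) {δ : ℝ} (hδ : ∀ x y, δ * π y ≤ P x y)
    (hπ1 : ∑ x, π x = 1) (hπ : ∀ y, ∑ x, π x * P x y = π y) (t : ℕ) {f : Ω → ℝ}
    (hf : ∑ x, π x * f x = 0) {c : ℝ} (hc : ∀ x, |f x| ≤ c) (x : Ω) :
    |∑ y, (P ^ t) x y * f y| ≤ (1 - δ) ^ t * c := by
  induction t generalizing f c with
  | zero => simpa [Matrix.one_apply] using hc x
  | succ t ih =>
    have hmean : ∑ x, π x * ∑ y, P x y * f y = 0 := by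
      simp only [mul_sum]
      rw [sum_comm]
      simp only [← mul_assoc, ← sum_mul, hπ, hf]
    have hbound : ∀ x, |∑ y, P x y * f y| ≤ (1 - δ) * c := fun x => by
      have h1 : ∑ y, P x y * f y = ∑ y, (P x y - δ * π y) * f y := by
        simp only [sub_mul, sum_sub_distrib, mul_assoc, ← mul_sum, hf]
        ring
      have h2 : ∑ y, (P x y - δ * π y) = 1 - δ := by
        rw [sum_sub_distrib, hP1, ← mul_sum, hπ1, mul_one]
      rw [h1, ← h2, sum_mul]
      refine (abs_sum_le_sum_abs _ _).trans (sum_le_sum fun y _ => ?_)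
      rw [abs_mul, abs_of_nonneg (sub_nonneg.2 (hδ x y))]
      exact mul_le_mul_of_nonneg_left (hc y) (sub_nonneg.2 (hδ x y))
    have := ih hmean hbound
    calc |∑ y, (P ^ (t + 1)) x y * f y|
        = |∑ y, (P ^ t) x y * ∑ z, P y z * f z| := by
          congr 1
          simp only [pow_succ, Matrix.mul_apply, mul_sum, sum_mul]
          rw [sum_comm]
          simp only [mul_assoc]
      _ ≤ _ := this
      _ = _ := by ring

/-- A finite chain one of whose powers is entrywise positive converges to its stationary
distribution in total variation, uniformly in the starting point. -/
theorem exists_tvDist_pow_le (hP1 : ∀ x, ∑ y, P x y = 1)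
    (hπ0 : ∀ x, 0 ≤ π x) (hπ1 : ∑ x, π x = 1) (hπ : ∀ y, ∑ x, π x * P x y = π y)
    {k : ℕ} (hk : ∀ x y, 0 < (P ^ k) x y) {ε : ℝ} (hε : 0 < ε) :
    ∃ t : ℕ, ∀ x, tvDist ((P ^ t) x) π ≤ ε := by
  obtain hΩ | hΩ := isEmpty_or_nonempty Ω
  · exact ⟨0, fun x => hΩ.elim x⟩
  obtain ⟨p, hp⟩ := Finite.exists_min fun p : Ω × Ω => (P ^ k) p.1 p.2
  have hπle : ∀ x, π x ≤ 1 := fun x =>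
    hπ1 ▸ single_le_sum (f := π) (fun y _ => hπ0 y) (mem_univ x)
  set δ := min ((P ^ k) p.1 p.2) 1 with hδ
  have hδ0 : 0 < δ := lt_min (hk _ _) one_pos
  have hδ1 : δ ≤ 1 := min_le_right _ _
  have hdom : ∀ x y, δ * π y ≤ (P ^ k) x y := fun x y =>
    (mul_le_of_le_one_right hδ0.le (hπle y)).trans ((min_le_left _ _).trans (hp (x, y)))
  obtain ⟨m, hm⟩ := exists_pow_lt_of_lt_one hε (sub_lt_self 1 hδ0)
  refine ⟨k * m, fun x => ciSup_le fun A => ?_⟩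
  set a := ∑ y ∈ A, π y with ha
  have ha0 : 0 ≤ a := sum_nonneg fun y _ => hπ0 y
  have ha1 : a ≤ 1 := hπ1 ▸ sum_le_sum_of_subset_of_nonneg (subset_univ A) fun y _ _ => hπ0 y
  have key := abs_sum_pow_mul_le (P := P ^ k) (sum_pow_apply hP1 k) hdom hπ1
    (stationary_pow hπ k) m (f := fun y => (if y ∈ A then 1 else 0) - a) (c := 1)
    (by simp [mul_sub, sum_sub_distrib, ← sum_mul, hπ1, ha])
    (fun y => by
      split_ifs <;> rw [abs_le] <;> constructor <;> linarith) x
  have hsum : ∑ y, ((P ^ k) ^ m) x y * ((if y ∈ A then 1 else 0) - a)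
      = ∑ y ∈ A, ((P ^ k) ^ m) x y - a := by
    simp [mul_sub, sum_sub_distrib, ← sum_mul, ← pow_mul, sum_pow_apply hP1]
  rw [hsum, ← pow_mul, mul_one] at key
  exact key.trans hm.le

end FiniteMarkovChain

section Glauber

variable {n : ℕ} (β K : ℝ)

theorem partitionFunction_pos (n : ℕ) : 0 < partitionFunction n β K :=
  sum_pos (fun _ _ => Real.exp_pos _) univ_nonempty

theorem gibbs_pos (ω : Config n) : 0 < gibbs n β K ω :=
  div_pos (Real.exp_pos _) (partitionFunction_pos β K n)

theorem sum_gibbs (n : ℕ) : ∑ ω, gibbs n β K ω = 1 := by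
  simp only [gibbs, ← sum_div]
  exact div_self (partitionFunction_pos β K n).ne'

theorem sum_gibbs_update_pos (ω : Config n) (i : Fin n) :
    0 < ∑ s : SignType, gibbs n β K (Function.update ω i s) :=
  sum_pos (fun _ _ => gibbs_pos β K _) univ_nonempty

theorem updateProb_pos (ω : Config n) (i : Fin n) (s : SignType) :
    0 < updateProb n β K ω i s :=
  div_pos (gibbs_pos β K _) (sum_gibbs_update_pos β K ω i)

theorem sum_updateProb (ω : Config n) (i : Fin n) : ∑ s, updateProb n β K ω i s = 1 := by
  simp only [updateProb, ← sum_div]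
  exact div_self (sum_gibbs_update_pos β K ω i).ne'

theorem glauber_nonneg (ω τ : Config n) : 0 ≤ glauber n β K ω τ := by
  refine mul_nonneg (by positivity) (sum_nonneg fun i _ => sum_nonneg fun s _ => ?_)
  split_ifs
  exacts [(updateProb_pos β K ω i s).le, le_rfl]

theorem sum_glauber (hn : 1 ≤ n) (ω : Config n) : ∑ τ, glauber n β K ω τ = 1 := by
  have hn' : (n : ℝ) ≠ 0 := by positivity
  simp only [glauber, ← mul_sum]
  rw [sum_comm]
  have h : ∀ i : Fin n, ∑ τ : Config n, ∑ s : SignType,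
      (if Function.update ω i s = τ then updateProb n β K ω i s else 0) = 1 := fun i => by
    rw [sum_comm]
    simp [sum_updateProb]
  simp [h, hn']

theorem glauber_update_pos (hn : 1 ≤ n) (ω : Config n) (i : Fin n) (s : SignType) :
    0 < glauber n β K ω (Function.update ω i s) := by
  have hnn : ∀ (j : Fin n) (s' : SignType), 0 ≤
      if Function.update ω j s' = Function.update ω i s then updateProb n β K ω j s' else 0 :=
    fun j s' => by
      split_ifs
      exacts [(updateProb_pos β K ω j s').le, le_rfl]
  refine mul_pos (by positivity) (sum_pos' (fun j _ => sum_nonneg fun s' _ => hnn j s')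
    ⟨i, mem_univ i, sum_pos' (fun s' _ => hnn i s') ⟨s, mem_univ s, ?_⟩⟩)
  rw [if_pos rfl]
  exact updateProb_pos β K ω i s

theorem glauber_pow_piecewise_pos (hn : 1 ≤ n) (ω τ : Config n) (I : Finset (Fin n)) :
    0 < (glauber n β K ^ #I) ω (I.piecewise τ ω) := by
  induction I using Finset.induction_on with
  | empty => simp
  | insert i I hi ih =>
    rw [card_insert_of_notMem hi, pow_succ, Matrix.mul_apply, piecewise_insert]
    exact sum_pos' (fun σ _ => mul_nonneg (pow_apply_nonneg (glauber_nonneg β K) _ _ _)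
      (glauber_nonneg β K _ _)) ⟨_, mem_univ _, mul_pos ih (glauber_update_pos β K hn _ i _)⟩

theorem glauber_pow_pos (hn : 1 ≤ n) (ω τ : Config n) : 0 < (glauber n β K ^ n) ω τ := by
  simpa using glauber_pow_piecewise_pos β K hn ω τ univ

theorem sum_ite_update_eq (ω τ : Config n) (i : Fin n) (f : SignType → ℝ) :
    ∑ s, (if Function.update ω i s = τ then f s else 0) =
      if Function.update ω i (τ i) = τ then f (τ i) else 0 := by
  refine sum_eq_single (τ i) (fun s _ hs => ?_) (by simp)
  refine if_neg fun h => hs ?_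
  rw [← h, Function.update_self]

theorem update_eq_symm {ω τ : Config n} {i : Fin n} (h : Function.update ω i (τ i) = τ) :
    Function.update τ i (ω i) = ω := by
  rw [← h]; simp

theorem glauber_reversible (ω τ : Config n) :
    gibbs n β K ω * glauber n β K ω τ = gibbs n β K τ * glauber n β K τ ω := by
  simp only [glauber, sum_ite_update_eq]
  rw [mul_left_comm, mul_left_comm (gibbs n β K τ), mul_sum (a := gibbs n β K ω),
    mul_sum (a := gibbs n β K τ)]
  congr 1
  refine sum_congr rfl fun i _ => ?_
  by_cases h : Function.update ω i (τ i) = τ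
  · have h' := update_eq_symm h
    have hZ : ∀ s, Function.update τ i s = Function.update ω i s := fun s => by
      rw [← h]; simp
    rw [if_pos h, if_pos h', updateProb, updateProb, h, h']
    simp only [hZ]
    ring
  · rw [if_neg h, if_neg fun h' => h (update_eq_symm h'), mul_zero, mul_zero]

theorem gibbs_stationary (hn : 1 ≤ n) (τ : Config n) :
    ∑ ω, gibbs n β K ω * glauber n β K ω τ = gibbs n β K τ := by
  simp only [glauber_reversible β K _ τ, ← mul_sum, sum_glauber β K hn, mul_one]

theorem tvDist_le_maxDist (t : ℕ) (ω : Config n) :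
    tvDist ((glauber n β K ^ t) ω) (gibbs n β K) ≤ maxDist n β K t :=
  le_ciSup (f := fun ω : Config n => tvDist ((glauber n β K ^ t) ω) (gibbs n β K))
    (Set.finite_range _).bddAbove ω

theorem maxDist_mixingTime_le (hn : 1 ≤ n) {ε : ℝ} (hε : 0 < ε) :
    maxDist n β K (mixingTime n β K ε) ≤ ε := by
  refine Nat.sInf_mem (s := {t : ℕ | maxDist n β K t ≤ ε}) ?_
  obtain ⟨t, ht⟩ := exists_tvDist_pow_le (sum_glauber β K hn) (fun ω => (gibbs_pos β K ω).le)
    (sum_gibbs β K n) (gibbs_stationary β K hn) (glauber_pow_pos β K hn) hε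
  exact ⟨t, ciSup_le ht⟩

/-- Bottleneck lower bound for the mixing time of the Glauber dynamics. -/
theorem gibbs_le_mixingTime_mul_flow (hn : 1 ≤ n) (A : Finset (Config n))
    (hA : ∑ ω ∈ A, gibbs n β K ω ≤ 1 / 2) :
    ∑ ω ∈ A, gibbs n β K ω ≤ 4 * (mixingTime n β K (1 / 4) *
      ∑ ω ∈ A, gibbs n β K ω * ∑ τ ∈ Aᶜ, glauber n β K ω τ) :=
  mass_le_of_tvDist_le (glauber_nonneg β K) (sum_glauber β K hn) (fun ω => (gibbs_pos β K ω).le)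
    (sum_gibbs β K n) (gibbs_stationary β K hn) A hA _
    fun ω => (tvDist_le_maxDist β K _ ω).trans (maxDist_mixingTime_le β K hn (by norm_num))

end Glauber

section FreeEnergy

theorem exists_lt_of_hasDerivAt_pos {f : ℝ → ℝ} {f' : ℝ} (hf : HasDerivAt f f' 0) (hf' : 0 < f') :
    ∃ h, 0 < h ∧ f 0 < f h := by
  have hev := (hasDerivAt_iff_tendsto_slope_zero.1 hf).eventually (lt_mem_nhds hf')
  have hev' : ∀ᶠ t in nhdsWithin (0 : ℝ) (Set.Ioi 0), 0 < t⁻¹ • (f (0 + t) - f 0) :=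
    hev.filter_mono (nhdsWithin_mono _ fun t (ht : 0 < t) => ht.ne')
  obtain ⟨t, ht, ht0⟩ := (hev'.and self_mem_nhdsWithin).exists
  have ht0' : 0 < t := ht0
  rw [zero_add, smul_eq_mul, mul_pos_iff_of_pos_left (inv_pos.2 ht0')] at ht
  exact ⟨t, ht0', sub_pos.1 ht⟩

/-- The single-spin partition function with external field `t`. -/
noncomputable def spinMGF (β t : ℝ) : ℝ := 1 + Real.exp (-β) * (Real.exp t + Real.exp (-t))

/-- The derivative of `spinMGF β`. -/
noncomputable def spinMGFDeriv (β t : ℝ) : ℝ := Real.exp (-β) * (Real.exp t - Real.exp (-t))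

theorem spinMGF_pos (β t : ℝ) : 0 < spinMGF β t := by unfold spinMGF; positivity

theorem hasDerivAt_spinMGF (β t : ℝ) : HasDerivAt (spinMGF β) (spinMGFDeriv β t) t := by
  have h := (((Real.hasDerivAt_exp t).add ((hasDerivAt_neg t).exp)).const_mul
    (Real.exp (-β))).const_add 1
  refine h.congr_deriv ?_
  unfold spinMGFDeriv
  ring

theorem hasDerivAt_spinMGFDeriv (β t : ℝ) :
    HasDerivAt (spinMGFDeriv β) (spinMGF β t - 1) t := by
  have h := ((Real.hasDerivAt_exp t).sub ((hasDerivAt_neg t).exp)).const_mul (Real.exp (-β))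
  refine h.congr_deriv ?_
  unfold spinMGF
  ring

theorem hasDerivAt_cumulant (β t : ℝ) :
    HasDerivAt (cumulant β) (spinMGFDeriv β t / spinMGF β t) t := by
  have hc : 0 < 1 + 2 * Real.exp (-β) := by positivity
  have h := ((hasDerivAt_spinMGF β t).div_const (1 + 2 * Real.exp (-β))).log
    (div_pos (spinMGF_pos β t) hc).ne'
  refine h.congr_deriv ?_
  have := (spinMGF_pos β t).ne'
  field_simp

theorem deriv_cumulant (β : ℝ) :
    deriv (cumulant β) = fun t => spinMGFDeriv β t / spinMGF β t :=
  funext fun t => (hasDerivAt_cumulant β t).deriv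

theorem hasDerivAt_deriv_cumulant (β t : ℝ) :
    HasDerivAt (fun t => spinMGFDeriv β t / spinMGF β t)
      (((spinMGF β t - 1) * spinMGF β t - spinMGFDeriv β t * spinMGFDeriv β t)
        / spinMGF β t ^ 2) t :=
  (hasDerivAt_spinMGFDeriv β t).div (hasDerivAt_spinMGF β t) (spinMGF_pos β t).ne'

theorem KcTwo_eq (β : ℝ) :
    KcTwo β = (1 + 2 * Real.exp (-β)) / (2 * β * (2 * Real.exp (-β))) := by
  have hc : 0 < 1 + 2 * Real.exp (-β) := by positivity
  have h0 : spinMGF β 0 = 1 + 2 * Real.exp (-β) := by simp [spinMGF]; ring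
  have h1 : spinMGFDeriv β 0 = 0 := by simp [spinMGFDeriv]
  rw [KcTwo, deriv_cumulant, (hasDerivAt_deriv_cumulant β 0).deriv, h0, h1]
  rcases eq_or_ne β 0 with rfl | hβ
  · simp
  · field_simp
    ring

theorem deriv_freeEnergy (β K : ℝ) :
    deriv (freeEnergy β K) = fun z =>
      2 * β * K * (z - spinMGFDeriv β (2 * β * K * z) / spinMGF β (2 * β * K * z)) := by
  funext z
  have hlin : HasDerivAt (fun z : ℝ => 2 * β * K * z) (2 * β * K) z := by
    simpa using (hasDerivAt_id z).const_mul (2 * β * K)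
  have h := (((hasDerivAt_id z).pow 2).const_mul (β * K)).sub
    ((hasDerivAt_cumulant β (2 * β * K * z)).comp z hlin)
  refine HasDerivAt.deriv (f := freeEnergy β K) (h.congr_deriv ?_)
  simp
  ring

theorem deriv_deriv_freeEnergy (β K z : ℝ) :
    deriv (deriv (freeEnergy β K)) z = 2 * β * K * (1 - 2 * β * K *
      (((spinMGF β (2 * β * K * z) - 1) * spinMGF β (2 * β * K * z)
        - spinMGFDeriv β (2 * β * K * z) * spinMGFDeriv β (2 * β * K * z))
          / spinMGF β (2 * β * K * z) ^ 2)) := by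
  have hlin : HasDerivAt (fun z : ℝ => 2 * β * K * z) (2 * β * K) z := by
    simpa using (hasDerivAt_id z).const_mul (2 * β * K)
  rw [deriv_freeEnergy]
  have h := ((hasDerivAt_id z).sub
    ((hasDerivAt_deriv_cumulant β (2 * β * K * z)).comp z hlin)).const_mul (2 * β * K)
  refine HasDerivAt.deriv (h.congr_deriv ?_)
  ring

/-- Up to a positive factor, `c_β'(x) - x c_β''(x)` with `a = e^β`. -/
noncomputable def tangency (a x : ℝ) : ℝ :=
  Real.sinh x * (a + 2 * Real.cosh x) - x * (a * Real.cosh x + 2)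

theorem hasDerivAt_tangency (a x : ℝ) :
    HasDerivAt (tangency a) (Real.sinh x * (4 * Real.sinh x - a * x)) x := by
  have h := ((Real.hasDerivAt_sinh x).mul (((Real.hasDerivAt_cosh x).const_mul 2).const_add a)).sub
    ((hasDerivAt_id x).mul (((Real.hasDerivAt_cosh x).const_mul a).add_const 2))
  refine h.congr_deriv ?_
  have := Real.cosh_sq x
  simp only [id]
  linear_combination 2 * this

theorem tangency_zero (a : ℝ) : tangency a 0 = 0 := by simp [tangency]

theorem continuous_tangency (a : ℝ) : Continuous (tangency a) :=
  continuous_iff_continuousAt.2 fun x => (hasDerivAt_tangency a x).continuousAt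

theorem tangency_root_unique {a x y : ℝ} (hx : 0 < x) (hxy : x < y) (hNx : tangency a x = 0)
    (hNy : tangency a y = 0) : False := by
  have rolle : ∀ u v : ℝ, u < v → tangency a u = tangency a v → 0 ≤ u →
      ∃ c ∈ Set.Ioo u v, 4 * Real.sinh c - a * c = 0 := fun u v huv h hu => by
    obtain ⟨c, hc, h0⟩ := exists_hasDerivAt_eq_zero huv (continuous_tangency a).continuousOn h
      fun x _ => hasDerivAt_tangency a x
    exact ⟨c, hc, (mul_eq_zero.1 h0).resolve_left
      (Real.sinh_pos_iff.2 (hu.trans_lt hc.1)).ne'⟩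
  have hd : ∀ c, HasDerivAt (fun c => 4 * Real.sinh c - a * c) (4 * Real.cosh c - a) c :=
    fun c => by
      have h := ((Real.hasDerivAt_sinh c).const_mul 4).sub ((hasDerivAt_id c).const_mul a)
      exact h.congr_deriv (by ring)
  have hcont : Continuous fun c => 4 * Real.sinh c - a * c :=
    continuous_iff_continuousAt.2 fun c => (hd c).continuousAt
  obtain ⟨c, hc, hc0⟩ := rolle 0 x hx (by rw [tangency_zero, hNx]) le_rfl
  obtain ⟨d, hd', hd0⟩ := rolle x y hxy (by rw [hNx, hNy]) hx.le
  obtain ⟨e, he, he0⟩ := exists_hasDerivAt_eq_zero hc.1 hcont.continuousOn (by simp [hc0])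
    fun x _ => hd x
  obtain ⟨f, hf, hf0⟩ := exists_hasDerivAt_eq_zero (hc.2.trans hd'.1) hcont.continuousOn
    (by simp [hc0, hd0]) fun x _ => hd x
  have := Real.cosh_strictMonoOn (Set.mem_Ici.2 he.1.le)
    (Set.mem_Ici.2 (he.1.le.trans (he.2.trans hf.1).le)) (he.2.trans hf.1)
  linarith

theorem exists_tangency_root {a : ℝ} (ha : 4 < a) : ∃ x, 0 < x ∧ tangency a x = 0 := by
  have hd : ∀ c, HasDerivAt (fun c => 4 * Real.sinh c - a * c) (4 * Real.cosh c - a) c :=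
    fun c => by
      have h := ((Real.hasDerivAt_sinh c).const_mul 4).sub ((hasDerivAt_id c).const_mul a)
      exact h.congr_deriv (by ring)
  have hnear : ∀ᶠ y in nhds (0 : ℝ), Real.cosh y < a / 4 :=
    Real.continuous_cosh.continuousAt.eventually_lt continuousAt_const
      (by rw [Real.cosh_zero]; linarith)
  obtain ⟨δ, hδ, hball⟩ := Metric.eventually_nhds_iff.1 hnear
  have hcosh : ∀ t, 0 < t → t < δ → Real.cosh t < a / 4 := fun t h0 h1 =>
    hball (by rw [Real.dist_eq, sub_zero, abs_of_pos h0]; exact h1)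
  have hslope : ∀ t, 0 < t → t < δ → 4 * Real.sinh t - a * t < 0 := fun t h0 h1 => by
    obtain ⟨c, hc, h⟩ := exists_hasDerivAt_eq_slope (fun c => 4 * Real.sinh c - a * c) _ h0
      (continuous_iff_continuousAt.2 fun c => (hd c).continuousAt).continuousOn fun x _ => hd x
    have := hcosh c hc.1 (hc.2.trans h1)
    rw [eq_div_iff (by linarith)] at h
    simp only [Real.sinh_zero] at h
    nlinarith
  have hneg : tangency a (δ / 2) < 0 := by
    obtain ⟨c, hc, h⟩ := exists_hasDerivAt_eq_slope (tangency a) _ (half_pos hδ)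
      (continuous_tangency a).continuousOn fun x _ => hasDerivAt_tangency a x
    have h1 := hslope c hc.1 (hc.2.trans (half_lt_self hδ))
    have h2 := mul_neg_of_pos_of_neg (Real.sinh_pos_iff.2 hc.1) h1
    rw [eq_div_iff (by linarith), tangency_zero] at h
    nlinarith
  have hpos : 0 < tangency a (4 * a) := by
    have h1 := Real.quadratic_le_exp_of_nonneg (x := 4 * a) (by linarith)
    have h2 : Real.exp (-(4 * a)) ≤ 1 := Real.exp_le_one_iff.2 (by linarith)
    have h3 : a * (4 * a) ≤ Real.sinh (4 * a) := by rw [Real.sinh_eq]; nlinarith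
    have h4 := Real.one_le_cosh (4 * a)
    have h5 : a * (4 * a) * (a + 2 * Real.cosh (4 * a))
        ≤ Real.sinh (4 * a) * (a + 2 * Real.cosh (4 * a)) :=
      mul_le_mul_of_nonneg_right h3 (by linarith)
    have h6 : 0 < a * (4 * a) := by positivity
    unfold tangency
    nlinarith
  obtain ⟨x, hx, h0⟩ := isPreconnected_Ioi.intermediate_value (s := Set.Ioi (0 : ℝ))
    (half_pos hδ) (show 0 < 4 * a by linarith) (continuous_tangency a).continuousOn
    ⟨hneg.le, hpos.le⟩
  exact ⟨x, hx, h0⟩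

theorem critical_and_inflection_iff {β K z : ℝ} (hβ : 0 < β) (hK : 0 < K) (hz : 0 < z) :
    (deriv (freeEnergy β K) z = 0 ∧ deriv (deriv (freeEnergy β K)) z = 0) ↔
      z * spinMGF β (2 * β * K * z) = spinMGFDeriv β (2 * β * K * z) ∧
        tangency (Real.exp β) (2 * β * K * z) = 0 := by
  have hk : 0 < 2 * β * K := by positivity
  rw [deriv_deriv_freeEnergy, deriv_freeEnergy]
  set x := 2 * β * K * z with hx
  have hφ := spinMGF_pos β x
  have h1 : 2 * β * K * (z - spinMGFDeriv β x / spinMGF β x) = 0 ↔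
      z * spinMGF β x = spinMGFDeriv β x := by
    rw [mul_eq_zero, or_iff_right hk.ne', sub_eq_zero, eq_div_iff hφ.ne']
  have ha : Real.exp β * Real.exp (-β) = 1 := by rw [← Real.exp_add]; simp
  have hφ' : spinMGF β x = 1 + 2 * Real.exp (-β) * Real.cosh x := by
    rw [spinMGF, Real.cosh_eq]; ring
  have hψ' : spinMGFDeriv β x = 2 * Real.exp (-β) * Real.sinh x := by
    rw [spinMGFDeriv, Real.sinh_eq]; ring
  dsimp only
  rw [h1]
  refine and_congr_right fun h => ?_
  have key : z * spinMGF β x ^ 2 * (1 - 2 * β * K * (((spinMGF β x - 1) * spinMGF β x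
      - spinMGFDeriv β x * spinMGFDeriv β x) / spinMGF β x ^ 2))
      = 2 * Real.exp (-β) ^ 2 * tangency (Real.exp β) x := by
    have e1 : z * spinMGF β x ^ 2 * (1 - 2 * β * K * (((spinMGF β x - 1) * spinMGF β x
      - spinMGFDeriv β x * spinMGFDeriv β x) / spinMGF β x ^ 2))
      = spinMGFDeriv β x * spinMGF β x - x * ((spinMGF β x - 1) * spinMGF β x
      - spinMGFDeriv β x * spinMGFDeriv β x) := by
      have e0 := mul_div_cancel₀ ((spinMGF β x - 1) * spinMGF β x
        - spinMGFDeriv β x * spinMGFDeriv β x) (pow_pos hφ 2).ne'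
      linear_combination (-(z * (2 * β * K))) * e0 + spinMGF β x * h +
        ((spinMGF β x - 1) * spinMGF β x - spinMGFDeriv β x * spinMGFDeriv β x) * hx
    rw [e1, hφ', hψ', tangency]
    linear_combination (2 * x * Real.exp (-β) * Real.cosh x
      - 2 * Real.exp (-β) * Real.sinh x) * ha - 4 * Real.exp (-β) ^ 2 * x * Real.cosh_sq x
  have hne : z * spinMGF β x ^ 2 ≠ 0 := by positivity
  have hne' : 2 * Real.exp (-β) ^ 2 ≠ 0 := by positivity
  rw [mul_eq_zero, or_iff_right hk.ne', ← mul_eq_zero_iff_left hne,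
    key, mul_eq_zero, or_iff_right hne']

theorem existsUnique_metastableCriticalValue {β : ℝ} (hβ : betaC < β) :
    ∃! K₁ : ℝ, IsMetastableCriticalValue β K₁ := by
  have hβ0 : 0 < β := (Real.log_pos (by norm_num)).trans hβ
  have ha : 4 < Real.exp β := (Real.log_lt_iff_lt_exp (by norm_num)).1 hβ
  obtain ⟨x, hx, hx0⟩ := exists_tangency_root ha
  have huniq : ∀ y, 0 < y → tangency (Real.exp β) y = 0 → y = x := fun y hy hy0 => by
    rcases lt_trichotomy y x with h | h | h
    · exact (tangency_root_unique hy h hy0 hx0).elim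
    · exact h
    · exact (tangency_root_unique hx h hx0 hy0).elim
  have hφ := spinMGF_pos β x
  have hψ : 0 < spinMGFDeriv β x :=
    mul_pos (Real.exp_pos _) (sub_pos.2 (Real.exp_lt_exp.2 (by linarith)))
  set z := spinMGFDeriv β x / spinMGF β x with hz
  have hz0 : 0 < z := div_pos hψ hφ
  have hKx : 2 * β * (x / (2 * β * z)) * z = x := by field_simp
  refine ⟨x / (2 * β * z), ⟨by positivity, z, ⟨hz0, ?_⟩, ?_⟩, ?_⟩
  · rw [critical_and_inflection_iff hβ0 (by positivity) hz0, hKx]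
    exact ⟨div_mul_cancel₀ _ hφ.ne', hx0⟩
  · rintro y ⟨hy, hcrit⟩
    rw [critical_and_inflection_iff hβ0 (by positivity) hy] at hcrit
    have h := huniq _ (by positivity) hcrit.2
    rw [h] at hcrit
    rw [hz, eq_div_iff hφ.ne', hcrit.1]
  · rintro K ⟨hK, y, ⟨hy, hcrit⟩, -⟩
    rw [critical_and_inflection_iff hβ0 hK hy] at hcrit
    have h := huniq _ (by positivity) hcrit.2
    rw [h] at hcrit
    have hyz : y = z := by rw [hz, eq_div_iff hφ.ne', hcrit.1]
    rw [eq_div_iff (by positivity), ← h, hyz]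
    ring

/-- The free energy decreases somewhere on the positive axis throughout the slow mixing regime. -/
theorem exists_mul_spinMGF_lt {β K : ℝ}
    (h : (0 < β ∧ β ≤ betaC ∧ KcTwo β < K) ∨
      (betaC < β ∧ ∃ K₁ : ℝ, IsMetastableCriticalValue β K₁ ∧ K₁ < K)) :
    0 < β ∧ 0 < K ∧
      ∃ z, 0 < z ∧ z * spinMGF β (2 * β * K * z) < spinMGFDeriv β (2 * β * K * z) := by
  rcases h with ⟨hβ, -, hK⟩ | ⟨hβ, K₁, ⟨hK₁, z, ⟨hz, hcrit⟩, -⟩, hK⟩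
  · rw [KcTwo_eq] at hK
    have hK0 : 0 < K := lt_trans (by positivity) hK
    refine ⟨hβ, hK0, ?_⟩
    rw [div_lt_iff₀ (by positivity)] at hK
    have hlin : HasDerivAt (fun z : ℝ => 2 * β * K * z) (2 * β * K) 0 := by
      simpa using (hasDerivAt_id (0 : ℝ)).const_mul (2 * β * K)
    have hd := ((hasDerivAt_spinMGFDeriv β (2 * β * K * 0)).comp 0 hlin).sub
      ((hasDerivAt_id (0 : ℝ)).mul ((hasDerivAt_spinMGF β (2 * β * K * 0)).comp 0 hlin))
    have hpos : 0 < (spinMGF β (2 * β * K * 0) - 1) * (2 * β * K) -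
        (1 * (spinMGF β ∘ fun z : ℝ => 2 * β * K * z) 0
          + id 0 * (spinMGFDeriv β (2 * β * K * 0) * (2 * β * K))) := by
      simp [spinMGF]
      linarith
    obtain ⟨z, hz, hz'⟩ := exists_lt_of_hasDerivAt_pos hd hpos
    refine ⟨z, hz, ?_⟩
    simpa [spinMGFDeriv] using hz'
  · have hβ0 : 0 < β := (Real.log_pos (by norm_num)).trans hβ
    have hK0 := hK₁.trans hK
    rw [critical_and_inflection_iff hβ0 hK₁ hz] at hcrit
    refine ⟨hβ0, hK0, K₁ * z / K, by positivity, ?_⟩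
    have hx : 2 * β * K * (K₁ * z / K) = 2 * β * K₁ * z := by field_simp
    rw [hx, ← hcrit.1]
    refine mul_lt_mul_of_pos_right ?_ (spinMGF_pos _ _)
    rw [div_lt_iff₀ hK0, mul_comm]
    exact mul_lt_mul_of_pos_left hK hz

/-- An exponential Chernoff factor for a drift exceeding `z`. -/
theorem exists_chernoff_factor {β x z : ℝ} (h : z * spinMGF β x < spinMGFDeriv β x) :
    ∃ θ, 0 < θ ∧ Real.exp (θ * z) * spinMGF β (x - θ) < spinMGF β x := by
  have hx : HasDerivAt (fun θ : ℝ => x - θ) (-1) 0 := (hasDerivAt_id (0 : ℝ)).const_sub x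
  have hd := ((((hasDerivAt_id (0 : ℝ)).mul_const z).exp).mul
    ((hasDerivAt_spinMGF β (x - 0)).comp 0 hx)).neg
  obtain ⟨θ, hθ, hlt⟩ := exists_lt_of_hasDerivAt_pos hd (by simp; linarith)
  exact ⟨θ, hθ, by simpa using hlt⟩

end FreeEnergy

section SlowMixing

variable {n : ℕ}

/-- Weight of a configuration for independent spins in the external field `x`. -/
noncomputable def tiltedWeight (β x : ℝ) (ω : Config n) : ℝ :=
  Real.exp (-β * ∑ j, (ω j : ℝ) ^ 2 + x * totalSpin ω)

theorem sum_tiltedWeight (β x : ℝ) : ∑ ω : Config n, tiltedWeight β x ω = spinMGF β x ^ n := by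
  have hspin : ∑ s : SignType, Real.exp (-β * (s : ℝ) ^ 2 + x * s) = spinMGF β x := by
    have huniv : (univ : Finset SignType) = {0, -1, 1} := rfl
    rw [huniv, sum_insert (by decide), sum_insert (by decide), sum_singleton, spinMGF, mul_add,
      ← Real.exp_add, ← Real.exp_add]
    simp
    ring
  rw [← hspin, Fintype.sum_pow]
  refine sum_congr rfl fun ω _ => ?_
  rw [← Real.exp_sum, tiltedWeight, totalSpin, mul_sum, mul_sum, sum_add_distrib]

theorem sum_tiltedWeight_lt_le (β x a : ℝ) {θ : ℝ} (hθ : 0 ≤ θ) :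
    ∑ ω : Config n with totalSpin ω < a, tiltedWeight β x ω
      ≤ Real.exp (θ * a) * spinMGF β (x - θ) ^ n := by
  rw [← sum_tiltedWeight, mul_sum]
  refine (sum_le_sum fun ω hω => ?_).trans (sum_le_sum_of_subset_of_nonneg (filter_subset _ _)
    fun ω _ _ => mul_nonneg (Real.exp_pos _).le (Real.exp_pos _).le)
  have h : totalSpin ω < a := (mem_filter.1 hω).2
  rw [tiltedWeight, tiltedWeight, ← Real.exp_add, Real.exp_le_exp]
  nlinarith [mul_nonneg hθ (sub_nonneg.2 h.le)]

theorem exp_neg_hamiltonian_eq (β K z : ℝ) (hn : 1 ≤ n) (ω : Config n) :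
    Real.exp (-β * hamiltonian n K ω) = Real.exp (β * K * (totalSpin ω - z * n) ^ 2 / n) *
      (Real.exp (-(β * K * z ^ 2 * n)) * tiltedWeight β (2 * β * K * z) ω) := by
  have hn' : (n : ℝ) ≠ 0 := by positivity
  rw [tiltedWeight, ← Real.exp_add, ← Real.exp_add, hamiltonian]
  congr 1
  field_simp
  ring

theorem totalSpin_update (ω : Config n) (i : Fin n) (s : SignType) :
    totalSpin (Function.update ω i s) = totalSpin ω + ((s : ℝ) - (ω i : ℝ)) := by
  have h : totalSpin (Function.update ω i s) - totalSpin ω = (s : ℝ) - (ω i : ℝ) := by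
    rw [totalSpin, totalSpin, ← sum_sub_distrib,
      sum_eq_single i (fun j _ hj => by rw [Function.update_of_ne hj, sub_self]) (by simp),
      Function.update_self]
  linarith

theorem totalSpin_neg (ω : Config n) : totalSpin (-ω) = -totalSpin ω := by
  simp [totalSpin]

theorem gibbs_neg (β K : ℝ) (ω : Config n) : gibbs n β K (-ω) = gibbs n β K ω := by
  simp [gibbs, hamiltonian, totalSpin_neg]

theorem sum_gibbs_le_half (β K : ℝ) {a : ℝ} (ha : 0 < a) :
    ∑ ω : Config n with a ≤ totalSpin ω, gibbs n β K ω ≤ 1 / 2 := by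
  have hsymm : ∑ ω : Config n with a ≤ totalSpin ω, gibbs n β K ω
      = ∑ ω : Config n with a ≤ -totalSpin ω, gibbs n β K ω := by
    rw [sum_filter, sum_filter, ← Equiv.sum_comp (Equiv.neg (Config n))]
    simp only [Equiv.neg_apply, totalSpin_neg, gibbs_neg]
  have hdisj : Disjoint (univ.filter fun ω : Config n => a ≤ totalSpin ω)
      (univ.filter fun ω : Config n => a ≤ -totalSpin ω) :=
    disjoint_filter.2 fun ω _ h1 h2 => by linarith
  have h := sum_le_sum_of_subset_of_nonneg (subset_univ (_ ∪ _))
    fun (ω : Config n) _ (_ : ω ∉ (univ.filter fun ω : Config n => a ≤ totalSpin ω) ∪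
      (univ.filter fun ω : Config n => a ≤ -totalSpin ω)) => (gibbs_pos β K ω).le
  rw [sum_union hdisj, sum_gibbs, ← hsymm] at h
  linarith

theorem glauber_eq_zero_of_totalSpin {β K : ℝ} {ω τ : Config n}
    (h : totalSpin τ + 2 < totalSpin ω) : glauber n β K ω τ = 0 := by
  refine mul_eq_zero_of_right _ (sum_eq_zero fun i _ => sum_eq_zero fun s _ => if_neg ?_)
  rintro rfl
  have hspin : ∀ s : SignType, -1 ≤ (s : ℝ) ∧ (s : ℝ) ≤ 1 := fun s => by
    cases s <;> norm_num
  rw [totalSpin_update] at h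
  linarith [(hspin s).1, (hspin (ω i)).2]

theorem flow_le_boundary (β K a : ℝ) (hn : 1 ≤ n) :
    ∑ ω : Config n with a ≤ totalSpin ω, gibbs n β K ω *
        ∑ τ ∈ (univ.filter fun ω : Config n => a ≤ totalSpin ω)ᶜ, glauber n β K ω τ
      ≤ ∑ ω : Config n with a ≤ totalSpin ω ∧ totalSpin ω < a + 2, gibbs n β K ω := by
  rw [← filter_filter, sum_filter (p := fun ω => totalSpin ω < a + 2)]
  refine sum_le_sum fun ω _ => ?_
  split_ifs with h
  · refine mul_le_of_le_one_right (gibbs_pos β K ω).le ?_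
    rw [← sum_glauber β K hn ω]
    exact sum_le_sum_of_subset_of_nonneg (subset_univ _) fun τ _ _ => glauber_nonneg β K ω τ
  · refine (mul_eq_zero_of_right _ (sum_eq_zero fun τ hτ => ?_)).le
    simp only [mem_compl, mem_filter, mem_univ, true_and, not_le] at hτ
    exact glauber_eq_zero_of_totalSpin (by linarith)

/-- The mixing time is bounded below through the Chernoff bound for the tilted product measure. -/
theorem pow_sub_pow_le_mixingTime {β K z θ : ℝ} (hβ : 0 < β) (hK : 0 < K) (hz : 0 < z)
    (hθ : 0 < θ) (hn : 1 ≤ n) :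
    spinMGF β (2 * β * K * z) ^ n
        - (Real.exp (θ * z) * spinMGF β (2 * β * K * z - θ)) ^ n
      ≤ 4 * (mixingTime n β K (1 / 4) * (Real.exp (4 * β * K + 2 * θ) *
        (Real.exp (θ * z) * spinMGF β (2 * β * K * z - θ)) ^ n)) := by
  have hn0 : (0 : ℝ) < n := by positivity
  have hn1 : (1 : ℝ) ≤ n := by exact_mod_cast hn
  have hbot := gibbs_le_mixingTime_mul_flow β K hn
    (univ.filter fun ω : Config n => z * n ≤ totalSpin ω) (sum_gibbs_le_half β K (by positivity))
  have hflow := flow_le_boundary β K (z * n) hn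
  set R := (Real.exp (θ * z) * spinMGF β (2 * β * K * z - θ)) ^ n with hR
  set x := 2 * β * K * z with hx
  set C := Real.exp (-(β * K * z ^ 2 * n)) / partitionFunction n β K with hC
  have hC0 : 0 < C := div_pos (Real.exp_pos _) (partitionFunction_pos β K n)
  have hgibbs : ∀ ω : Config n, gibbs n β K ω =
      Real.exp (β * K * (totalSpin ω - z * n) ^ 2 / n) * (C * tiltedWeight β x ω) := fun ω => by
    rw [gibbs, exp_neg_hamiltonian_eq β K z hn, hC]
    ring
  have hRa : ∀ a, ∑ ω : Config n with totalSpin ω < z * n + a, tiltedWeight β x ω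
      ≤ Real.exp (a * θ) * R := fun a => by
    refine (sum_tiltedWeight_lt_le β x _ hθ.le).trans (le_of_eq ?_)
    rw [hR, mul_pow, ← Real.exp_nat_mul, ← mul_assoc, ← Real.exp_add]
    congr 2
    ring
  have hlow : C * (spinMGF β x ^ n - R)
      ≤ ∑ ω : Config n with z * n ≤ totalSpin ω, gibbs n β K ω := by
    have h1 := sum_filter_add_sum_filter_not univ (fun ω : Config n => totalSpin ω < z * n)
      (tiltedWeight β x)
    have h2 := hRa 0
    simp only [not_lt, add_zero, zero_mul, Real.exp_zero, one_mul, sum_tiltedWeight] at h1 h2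
    calc C * (spinMGF β x ^ n - R)
        ≤ C * ∑ ω : Config n with z * n ≤ totalSpin ω, tiltedWeight β x ω :=
          mul_le_mul_of_nonneg_left (by linarith) hC0.le
      _ ≤ _ := by
          rw [mul_sum]
          refine sum_le_sum fun ω _ => ?_
          rw [hgibbs]
          exact le_mul_of_one_le_left (mul_pos hC0 (Real.exp_pos _)).le
            (Real.one_le_exp (by positivity))
  have hup : ∑ ω : Config n with z * n ≤ totalSpin ω ∧ totalSpin ω < z * n + 2, gibbs n β K ω
      ≤ C * (Real.exp (4 * β * K + 2 * θ) * R) := by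
    calc ∑ ω : Config n with z * n ≤ totalSpin ω ∧ totalSpin ω < z * n + 2, gibbs n β K ω
        ≤ ∑ ω : Config n with z * n ≤ totalSpin ω ∧ totalSpin ω < z * n + 2,
            Real.exp (4 * β * K) * (C * tiltedWeight β x ω) := by
          refine sum_le_sum fun ω hω => ?_
          obtain ⟨h1, h2⟩ := (mem_filter.1 hω).2
          rw [hgibbs]
          refine mul_le_mul_of_nonneg_right (Real.exp_le_exp.2 ?_)
            (mul_pos hC0 (Real.exp_pos _)).le
          have h3 : (totalSpin ω - z * n) ^ 2 ≤ 4 * n := by nlinarith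
          rw [div_le_iff₀ hn0]
          nlinarith [mul_le_mul_of_nonneg_left h3 (mul_pos hβ hK).le]
      _ ≤ ∑ ω : Config n with totalSpin ω < z * n + 2,
            Real.exp (4 * β * K) * (C * tiltedWeight β x ω) :=
          sum_le_sum_of_subset_of_nonneg
            (fun ω hω => mem_filter.2 ⟨mem_univ _, (mem_filter.1 hω).2.2⟩)
            fun ω _ _ => mul_nonneg (Real.exp_pos _).le (mul_pos hC0 (Real.exp_pos _)).le
      _ ≤ Real.exp (4 * β * K) * (C * (Real.exp (2 * θ) * R)) := by
          rw [← mul_sum, ← mul_sum]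
          gcongr
          exact hRa 2
      _ = _ := by rw [Real.exp_add]; ring
  refine le_of_mul_le_mul_left ?_ hC0
  have hT : (0 : ℝ) ≤ mixingTime n β K (1 / 4) := Nat.cast_nonneg _
  have h := mul_le_mul_of_nonneg_left (hflow.trans hup) hT
  linarith

/-- Trading a constant prefactor for a smaller exponential rate. -/
theorem exists_rate_of_one_le {c s : ℝ} (hc : 0 < c) (hs : 0 < s) :
    ∃ r, 0 < r ∧ ∀ y T : ℝ, 1 ≤ T → c * Real.exp (s * y) ≤ T →
      1 / 2 * Real.exp (r * y) ≤ T := by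
  have hl2 : 0 < Real.log 2 := Real.log_pos (by norm_num)
  set l := min 1 (Real.log 2 / (|Real.log c| + 1)) with hl
  have hl0 : 0 < l := lt_min one_pos (by positivity)
  have hlc : -Real.log 2 ≤ l * Real.log c := by
    have h1 : l * (|Real.log c| + 1) ≤ Real.log 2 :=
      (le_div_iff₀ (by positivity)).1 (min_le_right _ _)
    nlinarith [mul_le_mul_of_nonneg_left (neg_abs_le (Real.log c)) hl0.le]
  refine ⟨l * s, by positivity, fun y T hT h => ?_⟩
  have hlog : Real.log c + s * y ≤ Real.log T := by
    rw [← Real.log_exp (s * y), ← Real.log_mul hc.ne' (Real.exp_pos _).ne']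
    exact Real.log_le_log (by positivity) h
  have hlogT : l * Real.log T ≤ Real.log T :=
    mul_le_of_le_one_left (Real.log_nonneg hT) (min_le_left _ _)
  rw [← Real.log_le_log_iff (by positivity) (by linarith), Real.log_mul (by norm_num)
    (Real.exp_pos _).ne', Real.log_exp, one_div, Real.log_inv]
  nlinarith [mul_le_mul_of_nonneg_left hlog hl0.le]

theorem exists_mixingTime_rate {β K z : ℝ} (hβ : 0 < β) (hK : 0 < K) (hz : 0 < z)
    (h : z * spinMGF β (2 * β * K * z) < spinMGFDeriv β (2 * β * K * z)) :
    ∃ r, 0 < r ∧ ∀ n : ℕ, 1 ≤ n →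
      1 / 2 * Real.exp (r * n) ≤ (mixingTime n β K (1 / 4) : ℝ) := by
  obtain ⟨θ, hθ, hlt⟩ := exists_chernoff_factor h
  have hF := spinMGF_pos β (2 * β * K * z)
  have hR : 0 < Real.exp (θ * z) * spinMGF β (2 * β * K * z - θ) :=
    mul_pos (Real.exp_pos _) (spinMGF_pos _ _)
  have hmix := fun (n : ℕ) (hn : 1 ≤ n) => pow_sub_pow_le_mixingTime hβ hK hz hθ hn
  set F := spinMGF β (2 * β * K * z)
  set R := Real.exp (θ * z) * spinMGF β (2 * β * K * z - θ)
  set D := Real.exp (4 * β * K + 2 * θ)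
  have hD0 : 0 < D := Real.exp_pos _
  have hgap : 0 < 1 - R / F := sub_pos.2 ((div_lt_one hF).2 hlt)
  obtain ⟨r, hr, hrate⟩ := exists_rate_of_one_le (c := (1 - R / F) / (4 * D))
    (s := Real.log (F / R)) (by positivity) (Real.log_pos ((one_lt_div hR).2 hlt))
  refine ⟨r, hr, fun n hn => hrate n _ ?_ ?_⟩
  · by_contra hT
    have hT0 : mixingTime n β K (1 / 4) = 0 := by
      have : mixingTime n β K (1 / 4) < 1 := by exact_mod_cast not_le.1 hT
      omega
    have h0 := hmix n hn
    rw [hT0] at h0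
    have := pow_lt_pow_left₀ hlt hR.le (by omega : n ≠ 0)
    simp only [CharP.cast_eq_zero, zero_mul, mul_zero] at h0
    linarith
  · have hexp : Real.exp (Real.log (F / R) * n) = F ^ n / R ^ n := by
      rw [mul_comm, Real.exp_nat_mul, Real.exp_log (div_pos hF hR), div_pow]
    have hpow : (R / F) ^ n ≤ R / F :=
      pow_le_of_le_one (by positivity) (by linarith) (by omega)
    have hRF : R ^ n = (R / F) ^ n * F ^ n := by
      rw [div_pow, div_mul_cancel₀ _ (pow_pos hF n).ne']
    have h1 : (1 - R / F) * F ^ n ≤ F ^ n - R ^ n := by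
      rw [hRF]
      nlinarith [mul_le_mul_of_nonneg_right hpow (pow_pos hF n).le]
    have hRn := pow_pos hR n
    rw [hexp, div_mul_div_comm, div_le_iff₀ (by positivity)]
    linarith [hmix n hn]

end SlowMixing

end BlumeCapel

open BlumeCapel in
/-- For `β > β_c` the metastable critical value `K_1(β)` is well defined, and the Glauber dynamics
of the Blume-Capel model mixes slowly for `0 < β ≤ β_c`, `K > K_c^{(2)}(β)` and for `β > β_c`,
`K > K_1(β)`. -/
theorem mainTheorem3 :
    (∀ β : ℝ, betaC < β → ∃! K₁ : ℝ, IsMetastableCriticalValue β K₁) ∧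
    ∃ b : ℝ, 0 < b ∧ ∃ r : ℝ → ℝ → ℝ, ∀ β K : ℝ,
      ((0 < β ∧ β ≤ betaC ∧ KcTwo β < K) ∨
        (betaC < β ∧ ∃ K₁ : ℝ, IsMetastableCriticalValue β K₁ ∧ K₁ < K)) →
      0 < r β K ∧
        ∀ n : ℕ, 1 ≤ n → b * Real.exp (r β K * n) ≤ (mixingTime n β K (1 / 4) : ℝ) := by
  refine ⟨fun β hβ => existsUnique_metastableCriticalValue hβ, 1 / 2, by norm_num, ?_⟩
  have hrate : ∀ β K : ℝ,
      ((0 < β ∧ β ≤ betaC ∧ KcTwo β < K) ∨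
        (betaC < β ∧ ∃ K₁ : ℝ, IsMetastableCriticalValue β K₁ ∧ K₁ < K)) →
      ∃ r : ℝ, 0 < r ∧ ∀ n : ℕ, 1 ≤ n →
        1 / 2 * Real.exp (r * n) ≤ (mixingTime n β K (1 / 4) : ℝ) := fun β K h => by
    obtain ⟨hβ, hK, z, hz, hlt⟩ := exists_mul_spinMGF_lt h
    exact exists_mixingTime_rate hβ hK hz hlt
  choose! r hr using hrate
  exact ⟨r, hr⟩
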